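/- Let $n\ge 1$ be an integer and let $p$ be a prime number. A monic polynomial $f$ of degree $n$ over a field $K$ is called a Casas--Alvero polynomial if for each $i\in\{1,\dots,n-1\}$ it has a non-constant common factor with its $i$-th Hasse derivative $H_i(f)$, where $H_i\bigl(\sum_k c_kx^k\bigr)=\sum_k\binom{k}{i}c_kx^{k-i}$. Let $\mathrm{CA}_{n,p}$ be the statement: for every algebraically closed field $K$ of characteristic $p$, every monic Casas--Alvero polynomial $f\in K[x]$ of degree $n$ is of the form $f=(x-b)^n$ with $b\in K$. The prime $p$ is called a bad prime for $n$ if $\mathrm{CA}_{n,p}$ is false. For $1\le j\le n-1$ let $\Phi_j$ be the endomorphism of the ring $\mathbb Z[x_1,\dots,x_{n-1}]$ with $\Phi_j(x_k)=x_k-x_j$ for $k\ne j$ and $\Phi_j(x_j)=-x_j$, and let $\Phi_n$ be the identity. Let $\sigma_i$ be the $i$-th elementary symmetric polynomial in $x_1,\dots,x_{n-1}$. Put $\mathcal T=\{1,\dots,n\}^{n-1}$, and for $T=(j_1,\dots,j_{n-1})\in\mathcal T$ and $1\le i\le n-1$ let $G_{T,i}=\Phi_{j_i}(\sigma_i)$,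 a homogeneous polynomial of degree $i$. Let $d=\frac{n^2-3n+4}{2}$, and let $C$ be the number of monomials of degree $d$ in the $n-1$ variables $x_1,\dots,x_{n-1}$ (so $C=\binom{(n^2-n)/2}{n-2}$ if $n\ge 2$, and $C=0$ if $n=1$). For $T\in\mathcal T$ let $M_T$ be the integer matrix with $C$ columns, indexed by the monomials of degree $d$, and with one row for each pair $(i,\alpha)$, where $1\le i\le n-1$ and $\alpha\in\mathbb Z_{\ge 0}^{n-1}$ satisfies $|\alpha|=d-i$; the row of $(i,\alpha)$ consists of the coefficients of the polynomial $G_{T,i}\,x^\alpha$. Let $J_T\ge 0$ be the greatest common divisor of all the $C\times C$ minors of $M_T$ (with $J_T=0$ if all of them vanish; the empty minor, which occurs for $n=1$, equals $1$). Then $p$ is a bad prime for $n$ if and only if $p\mid J_T$ for some $T\in\mathcal T$; equivalently, $p$ is a bad prime for $n$ if and only if $p\mid\operatorname{lcm}(J_T)_{T\in\mathcal T}$ (where the least common multiple is $0$ if some $J_T$ is $0$). -/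

import Mathlib

universe u

/-- `f` is a Casas-Alvero polynomial: it has a non-constant common factor with each of its Hasse
derivatives `H_i(f)`, `1 ≤ i ≤ deg f - 1`. -/
def IsCasasAlvero {K : Type*} [Field K] (f : Polynomial K) : Prop :=
  ∀ i : ℕ, 1 ≤ i → i < f.natDegree →
    ∃ g : Polynomial K, 0 < g.natDegree ∧ g ∣ f ∧ g ∣ Polynomial.hasseDeriv i f

/-- The statement `CA_{n,p}`: over every algebraically closed field of characteristic `p`, every
monic Casas-Alvero polynomial of degree `n` is of the form `(x - b) ^ n`. -/
def CasasAlveroHolds (n p : ℕ) : Prop :=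
  ∀ (K : Type u) [Field K] [IsAlgClosed K] [CharP K p] (f : Polynomial K),
    f.Monic → f.natDegree = n → IsCasasAlvero f →
      ∃ b : K, f = (Polynomial.X - Polynomial.C b) ^ n

/-- The prime `p` is a bad prime for `n` if `CA_{n,p}` is false. -/
def IsBadPrime (n p : ℕ) : Prop :=
  p.Prime ∧ ¬ CasasAlveroHolds.{u} n p

namespace CasasAlvero

/-- The substitution `Φ_j` on polynomials in the variables `x_1, …, x_{n-1}`, for `1 ≤ j ≤ n`
(indices are shifted by one: `x_k` is the variable with value `k - 1` in `Fin (n - 1)`, and `j` is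
the element with value `j - 1` in `Fin n`). For `j < n` it maps `x_j` to `-x_j` and `x_k` to
`x_k - x_j` when `k ≠ j`; and `Φ_n` is the identity. -/
noncomputable def shift (R : Type*) [CommRing R] (n : ℕ) (j : Fin n) :
    MvPolynomial (Fin (n - 1)) R →ₐ[R] MvPolynomial (Fin (n - 1)) R :=
  if h : (j : ℕ) < n - 1 then
    MvPolynomial.aeval fun k : Fin (n - 1) =>
      if k = ⟨j, h⟩ then -MvPolynomial.X k
      else MvPolynomial.X k - MvPolynomial.X ⟨j, h⟩
  else AlgHom.id R _

/-- The set `𝒯 = {1, …, n} ^ (n - 1)` of tuples. -/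
abbrev Tuple (n : ℕ) : Type := Fin (n - 1) → Fin n

/-- The polynomial `G_{T,i} = Φ_{j_i}(σ_i)` with integer coefficients, where `T = (j_1, …, j_{n-1})`
and `σ_i` is the `i`-th elementary symmetric polynomial (`i : Fin (n - 1)` stands for the
index `i + 1`). -/
noncomputable def G (n : ℕ) (T : Tuple n) (i : Fin (n - 1)) : MvPolynomial (Fin (n - 1)) ℤ :=
  shift ℤ n (T i) (MvPolynomial.esymm (Fin (n - 1)) ℤ (i + 1))

/-- The degree `d = (n² - 3n + 4) / 2`. -/
def macaulayDegree (n : ℕ) : ℕ := (n ^ 2 + 4 - 3 * n) / 2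

/-- The multi-indices `α` in `m` variables with `|α| = e`. -/
abbrev MultiIndex (m e : ℕ) : Type := {α : Fin m →₀ ℕ // ∑ k, α k = e}

instance instFintypeMultiIndex (m e : ℕ) : Fintype (MultiIndex m e) :=
  Fintype.subtype (Finset.finsuppAntidiag Finset.univ e) (by simp [Finset.mem_finsuppAntidiag])

/-- The columns of `M_T`: the monomials of degree `d` in `n - 1` variables. -/
abbrev Col (n : ℕ) : Type := MultiIndex (n - 1) (macaulayDegree n)

/-- The rows of `M_T`: the pairs `(i, α)` with `1 ≤ i ≤ n - 1` and `|α| = d - i`. -/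
abbrev Row (n : ℕ) : Type :=
  Σ i : Fin (n - 1), MultiIndex (n - 1) (macaulayDegree n - (i + 1))

/-- Sanity check: the degree `d` is `1 + 2 + ⋯ + (n - 1) - (n - 2)`. -/
theorem macaulayDegree_add (n : ℕ) (hn : 1 ≤ n) :
    macaulayDegree n + n = (∑ i : Fin (n - 1), ((i : ℕ) + 1)) + 2 := by
  obtain ⟨m, rfl⟩ := Nat.exists_eq_add_of_le' hn
  have h1 : (∑ i : Fin (m + 1 - 1), ((i : ℕ) + 1)) * 2 = m * (m + 1) := by
    rw [Fin.sum_univ_eq_sum_range (fun i => i + 1), Nat.add_sub_cancel]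
    induction m with
    | zero => simp
    | succ k ih => rw [Finset.sum_range_succ, add_mul, ih (by omega)]; ring
  have h2 : (m + 1) ^ 2 = m * (m + 1) + m + 1 := by ring
  unfold macaulayDegree
  rw [h2, ← h1]
  have h3 : m ≤ (∑ i : Fin (m + 1 - 1), ((i : ℕ) + 1)) := by
    calc m = ∑ i : Fin (m + 1 - 1), 1 := by simp
      _ ≤ _ := Finset.sum_le_sum fun i _ => by omega
  omega

/-- Every `i ≤ n - 1` satisfies `i ≤ d`, so that the subtraction `d - i` is the true one. -/
theorem le_macaulayDegree (n : ℕ) (i : Fin (n - 1)) : (i : ℕ) + 1 ≤ macaulayDegree n := by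
  have hi := i.isLt
  unfold macaulayDegree
  rw [Nat.le_div_iff_mul_le two_pos]
  obtain ⟨m, rfl⟩ : ∃ m, n = m + 2 := ⟨n - 2, by omega⟩
  have h : m ≤ m ^ 2 := Nat.le_self_pow two_ne_zero m
  have h2 : (m + 2) ^ 2 = m ^ 2 + 4 * m + 4 := by ring
  rw [h2]
  omega

/-- Sanity check: for `n ≥ 2` the number `C` of columns is the binomial coefficient
`((n² - n) / 2 choose n - 2)`. -/
theorem card_col (n : ℕ) (hn : 2 ≤ n) :
    Fintype.card (Col n) = ((n ^ 2 - n) / 2).choose (n - 2) := by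
  obtain ⟨m, rfl⟩ : ∃ m, n = m + 2 := ⟨n - 2, by omega⟩
  have h : m + macaulayDegree (m + 2) = ((m + 2) ^ 2 - (m + 2)) / 2 := by
    have h2 : (m + 2) ^ 2 = m ^ 2 + 4 * m + 4 := by ring
    have h3 : m ≤ m ^ 2 := Nat.le_self_pow two_ne_zero m
    unfold macaulayDegree
    omega
  rw [Fintype.card_of_subtype (Finset.finsuppAntidiag Finset.univ (macaulayDegree (m + 2)))
    (by simp [Finset.mem_finsuppAntidiag]), Finset.card_finsuppAntidiag_nat_eq_choose, ← h,
    Finset.card_univ, Fintype.card_fin,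
    show m + 2 - 1 + macaulayDegree (m + 2) - 1 = m + macaulayDegree (m + 2) by omega,
    Nat.add_sub_cancel]
  exact (Nat.choose_symm_add).symm

/-- The integer matrix `M_T`: its rows are the coefficient vectors of the products `G_{T,i} x ^ α`
with `|α| = d - i` in the basis of the monomials of degree `d`. -/
noncomputable def M (n : ℕ) (T : Tuple n) : Matrix (Row n) (Col n) ℤ :=
  Matrix.of fun r c =>
    MvPolynomial.coeff c.1 (G n T r.1 * MvPolynomial.monomial r.2.1 1)

/-- The number `J_T`: the greatest common divisor of the maximal (`C × C`) minors of `M_T`. A minor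
is given by a choice of `C` distinct rows; listing the same rows in another order only changes the
sign. The gcd is normalized to be nonnegative; it is `0` if all minors vanish. -/
noncomputable def J (n : ℕ) (T : Tuple n) : ℤ :=
  (Finset.univ : Finset (Col n ↪ Row n)).gcd fun s => ((M n T).submatrix s id).det

end CasasAlvero

/-!
A monic polynomial of degree `n` over an algebraically closed field splits with roots
`b_1, …, b_n`. It is a Casas-Alvero polynomial when for each `i` one of the roots, `b_j`, is a root
of the Hasse derivative of order `n - i`. By Taylor expansion at `b_j` and Vieta's formulas the
value of this derivative at `b_j` is, up to sign, the `i`-th elementary symmetric polynomial of the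
differences of the other roots with `b_j`; after translating `b_n` to `0` it is the value of
`G_{T,i}` at the roots, where `T` records the choices of `j`. So `CA_{n,p}` fails if and only if for some `T` the forms
`G_{T,1}, …, G_{T,n-1}` have a nontrivial common zero in characteristic `p`
(`forall_isCasasAlvero_iff`).

On the other hand `p ∣ J_T` says that the rows of `M_T` do not span modulo `p`, that is, that the
forms `G_{T,i}` do not generate all forms of degree `d`. If they do, then every power `x_k ^ d`
vanishes at a common zero, which is therefore trivial. The converse is Macaulay's bound
(`OnlyTrivialZero.containsFrom`): as many forms as there are variables, of degrees `d_i` and without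
nontrivial common zero, generate all forms of degree greater than `∑ (d_i - 1)`. The two directions
are combined in `dvd_J_iff`.

Macaulay's bound is obtained by exchange from the family of the variables, for which it is clear.
If `f` and `h` are forms such that the quotients by `I + (f)` and `I + (h)` vanish in high degrees,
and `f` is a nonzerodivisor modulo `I`, then comparing dimensions in each degree shows that `h` is a
nonzerodivisor modulo `I` as well, and relates the degrees from which the two quotients vanish
(`RegularModulo.exchange`). Hence replacing one form of a family keeps both the bound and the fact
that all subfamilies are regular sequences (`IsMacaulayFamily.update`). Any two families without
nontrivial zeros are joined by such replacements (`IsMacaulayFamily.transfer`): a member of a family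
can be replaced by any linear form that does not vanish on the finitely many lines cut out by the
other members, and one linear form can be chosen for both families.
-/

namespace CasasAlvero

attribute [local instance] MvPolynomial.gradedAlgebra

/-! ### Nonzerodivisors modulo homogeneous ideals and the exchange principle -/

section Graded

open MvPolynomial

variable {σ K : Type*} [Field K]

/-- The polynomial `f` is a nonzerodivisor modulo `I`, as far as homogeneous multiples are
concerned. For a homogeneous ideal and a homogeneous `f` this is the usual notion. -/
def RegularModulo (I : Ideal (MvPolynomial σ K)) (f : MvPolynomial σ K) : Prop :=
  ∀ (e : ℕ) (u : MvPolynomial σ K), u.IsHomogeneous e → u * f ∈ I → u ∈ I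

/-- The ideal `I` contains all forms of degree at least `a`. -/
def ContainsFrom (I : Ideal (MvPolynomial σ K)) (a : ℕ) : Prop :=
  ∀ (e : ℕ) (u : MvPolynomial σ K), a ≤ e → u.IsHomogeneous e → u ∈ I

theorem ContainsFrom.mono {I J : Ideal (MvPolynomial σ K)} {a b : ℕ} (h : ContainsFrom I a)
    (hIJ : I ≤ J) (hab : a ≤ b) : ContainsFrom J b :=
  fun e u he hu => hIJ (h e u (hab.trans he) hu)

theorem homogeneousComponent_mul_right {d : ℕ} {f : MvPolynomial σ K} (hf : f.IsHomogeneous d)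
    (u : MvPolynomial σ K) (e : ℕ) :
    homogeneousComponent e (u * f) = if d ≤ e then homogeneousComponent (e - d) u * f else 0 := by
  have := DirectSum.coe_decompose_mul_of_right_mem (homogeneousSubmodule σ K) (a := u) e
    (i := d) (b := f) hf
  rw [← decomposition.decompose'_apply, ← decomposition.decompose'_apply]
  exact this

/-- Membership of a form in `I + (f)` can be witnessed by a homogeneous multiple of `f`. -/
theorem exists_isHomogeneous_sub_mul_mem {I : Ideal (MvPolynomial σ K)}
    (hI : I.IsHomogeneous (homogeneousSubmodule σ K)) {d e : ℕ} {f u : MvPolynomial σ K}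
    (hf : f.IsHomogeneous d) (hu : u.IsHomogeneous e) (h : u ∈ I ⊔ Ideal.span {f}) :
    ∃ v : MvPolynomial σ K, (∀ k, k + d = e → v.IsHomogeneous k) ∧ (e < d → v = 0) ∧
      u - v * f ∈ I := by
  obtain ⟨w, hw, z, hz, rfl⟩ := Submodule.mem_sup.1 h
  obtain ⟨c, rfl⟩ := Ideal.mem_span_singleton'.1 hz
  refine ⟨if d ≤ e then homogeneousComponent (e - d) c else 0, ?_, ?_, ?_⟩
  · rintro k rfl
    simpa using homogeneousComponent_isHomogeneous k c
  · intro h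
    rw [if_neg (by omega)]
  · have h1 := homogeneousComponent_mem_of_mem hI hw e
    have h2 := homogeneousComponent_eq_self hu
    rw [map_add, homogeneousComponent_mul_right hf] at h2
    rw [← h2]
    split_ifs with h3 <;> simpa [h3] using h1

theorem isHomogeneous_span {s : Set (MvPolynomial σ K)}
    (hs : ∀ f ∈ s, ∃ d, f.IsHomogeneous d) :
    (Ideal.span s).IsHomogeneous (homogeneousSubmodule σ K) :=
  Ideal.homogeneous_span _ _ fun f hf => by
    obtain ⟨d, hd⟩ := hs f hf
    exact ⟨d, hd⟩

/-- The graded form of Nakayama's lemma for regularity: it descends along a nonzerodivisor of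
positive degree. -/
theorem RegularModulo.of_sup {I : Ideal (MvPolynomial σ K)}
    (hI : I.IsHomogeneous (homogeneousSubmodule σ K)) {d d' : ℕ} {a h : MvPolynomial σ K}
    (ha : a.IsHomogeneous d) (hd : 0 < d) (hh : h.IsHomogeneous d')
    (ra : RegularModulo I a) (rh : RegularModulo (I ⊔ Ideal.span {a}) h) :
    RegularModulo I h := by
  intro e
  induction e using Nat.strong_induction_on with
  | _ e ih =>
    intro u hu hmem
    obtain ⟨v, hv, hv0, huv⟩ := exists_isHomogeneous_sub_mul_mem hI ha hu
      (rh e u hu (Ideal.mem_sup_left hmem))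
    rcases lt_or_ge e d with hlt | hge
    · simpa [hv0 hlt] using huv
    · obtain ⟨k, rfl⟩ := Nat.exists_eq_add_of_le' hge
      have hvk := hv k rfl
      have h1 : v * h * a ∈ I := by
        have := I.sub_mem hmem (I.mul_mem_right h huv)
        convert this using 1
        ring
      have h2 := ih k (by omega) v hvk (ra _ _ (hvk.mul hh) h1)
      simpa using I.add_mem huv (I.mul_mem_right a h2)

/-- If `a, b` is a regular sequence modulo `I`, then `a` is regular modulo `I + (b)`. -/
theorem RegularModulo.swap {I : Ideal (MvPolynomial σ K)}
    (hI : I.IsHomogeneous (homogeneousSubmodule σ K)) {d d' : ℕ} {a b : MvPolynomial σ K}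
    (ha : a.IsHomogeneous d) (hb : b.IsHomogeneous d')
    (ra : RegularModulo I a) (rb : RegularModulo (I ⊔ Ideal.span {a}) b) :
    RegularModulo (I ⊔ Ideal.span {b}) a := by
  intro e u hu hmem
  obtain ⟨v, hv, hv0, huv⟩ := exists_isHomogeneous_sub_mul_mem hI hb (hu.mul ha) hmem
  rcases lt_or_ge (e + d) d' with hlt | hge
  · exact Ideal.mem_sup_left (ra e u hu (by simpa [hv0 hlt] using huv))
  · obtain ⟨k, hk⟩ := Nat.exists_eq_add_of_le' hge
    have hvk := hv k hk.symm
    have hvb : v * b ∈ I ⊔ Ideal.span {a} := by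
      have := Ideal.sub_mem (I ⊔ Ideal.span {a})
        (Ideal.mul_mem_left _ u (Ideal.mem_sup_right (Ideal.mem_span_singleton_self a)))
        (Ideal.mem_sup_left huv)
      simpa using this
    obtain ⟨w, hw, hw0, hvw⟩ := exists_isHomogeneous_sub_mul_mem hI ha hvk (rb k v hvk hvb)
    have hwb : (w * b).IsHomogeneous e := by
      rcases lt_or_ge k d with hlt | hge
      · rw [hw0 hlt, zero_mul]
        exact isHomogeneous_zero _ _ _
      · obtain ⟨l, rfl⟩ := Nat.exists_eq_add_of_le' hge
        convert (hw l rfl).mul hb using 1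
        omega
    have h1 : (u - w * b) * a ∈ I := by
      have := I.add_mem huv (I.mul_mem_right b hvw)
      convert this using 1
      ring
    have h2 := ra e _ (hu.sub hwb) h1
    have := Ideal.add_mem _ (Ideal.mem_sup_left (T := Ideal.span {b}) h2)
      (Ideal.mul_mem_left _ w (Ideal.mem_sup_right (Ideal.mem_span_singleton_self b)))
    simpa using this

/-- The forms of degree `e` that lie in `I`. -/
noncomputable def formsIn (I : Ideal (MvPolynomial σ K)) (e : ℕ) :
    Submodule K (homogeneousSubmodule σ K e) :=
  (I.restrictScalars K).comap (homogeneousSubmodule σ K e).subtype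

/-- The Hilbert function of the quotient by `I`. -/
noncomputable def hilbert (I : Ideal (MvPolynomial σ K)) (e : ℕ) : ℕ :=
  Module.finrank K (homogeneousSubmodule σ K e ⧸ formsIn I e)

theorem mem_formsIn {I : Ideal (MvPolynomial σ K)} {e : ℕ} {u : homogeneousSubmodule σ K e} :
    u ∈ formsIn I e ↔ (u : MvPolynomial σ K) ∈ I := Iff.rfl

/-- Multiplication by a form `f` of degree `d`, from degree `e` to degree `e + d`. -/
noncomputable def mulForm {d : ℕ} {f : MvPolynomial σ K} (hf : f.IsHomogeneous d) (e : ℕ) :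
    homogeneousSubmodule σ K e →ₗ[K] homogeneousSubmodule σ K (e + d) :=
  ((LinearMap.mulRight K f).comp (homogeneousSubmodule σ K e).subtype).codRestrict _
    fun u => IsHomogeneous.mul u.2 hf

theorem coe_mulForm {d : ℕ} {f : MvPolynomial σ K} (hf : f.IsHomogeneous d) (e : ℕ)
    (u : homogeneousSubmodule σ K e) : (mulForm hf e u : MvPolynomial σ K) = u * f := rfl

theorem formsIn_le_comap_mulForm (I : Ideal (MvPolynomial σ K)) {d : ℕ} {f : MvPolynomial σ K}
    (hf : f.IsHomogeneous d) (e : ℕ) : formsIn I e ≤ (formsIn I (e + d)).comap (mulForm hf e) :=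
  fun _ hu => I.mul_mem_right f hu

/-- Multiplication by a form `f` of degree `d` on the quotient by `I`, from degree `e` to degree
`e + d`. -/
noncomputable def mulQuot (I : Ideal (MvPolynomial σ K)) {d : ℕ} {f : MvPolynomial σ K}
    (hf : f.IsHomogeneous d) (e : ℕ) :
    (homogeneousSubmodule σ K e ⧸ formsIn I e) →ₗ[K]
      (homogeneousSubmodule σ K (e + d) ⧸ formsIn I (e + d)) :=
  Submodule.mapQ _ _ (mulForm hf e) (formsIn_le_comap_mulForm I hf e)

variable {I : Ideal (MvPolynomial σ K)} {d : ℕ} {f : MvPolynomial σ K}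

theorem mulQuot_injective_iff (hf : f.IsHomogeneous d) (e : ℕ) :
    Function.Injective (mulQuot I hf e) ↔
      ∀ u : MvPolynomial σ K, u.IsHomogeneous e → u * f ∈ I → u ∈ I := by
  rw [injective_iff_map_eq_zero]
  constructor
  · intro h u hu hm
    have := h (Submodule.Quotient.mk ⟨u, hu⟩) (by
      rw [mulQuot, Submodule.mapQ_apply, Submodule.Quotient.mk_eq_zero]
      exact hm)
    rwa [Submodule.Quotient.mk_eq_zero] at this
  · intro h x
    obtain ⟨u, rfl⟩ := Submodule.Quotient.mk_surjective _ x
    rw [mulQuot, Submodule.mapQ_apply, Submodule.Quotient.mk_eq_zero,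
      Submodule.Quotient.mk_eq_zero]
    exact h u u.2

theorem mulQuot_surjective_iff (hI : I.IsHomogeneous (homogeneousSubmodule σ K))
    (hf : f.IsHomogeneous d) (e : ℕ) :
    Function.Surjective (mulQuot I hf e) ↔
      ∀ u : MvPolynomial σ K, u.IsHomogeneous (e + d) → u ∈ I ⊔ Ideal.span {f} := by
  constructor
  · intro h u hu
    obtain ⟨x, hx⟩ := h (Submodule.Quotient.mk ⟨u, hu⟩)
    obtain ⟨v, rfl⟩ := Submodule.Quotient.mk_surjective _ x
    rw [mulQuot, Submodule.mapQ_apply, Submodule.Quotient.eq] at hx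
    have h1 : (v : MvPolynomial σ K) * f - u ∈ I := hx
    have h2 := Ideal.sub_mem (I ⊔ Ideal.span {f})
      (Ideal.mul_mem_left _ v.1 (Ideal.mem_sup_right (Ideal.mem_span_singleton_self f)))
      (Ideal.mem_sup_left h1)
    simpa using h2
  · intro h x
    obtain ⟨u, rfl⟩ := Submodule.Quotient.mk_surjective _ x
    obtain ⟨v, hv, -, huv⟩ := exists_isHomogeneous_sub_mul_mem hI hf u.2 (h u u.2)
    refine ⟨Submodule.Quotient.mk ⟨v, hv e rfl⟩, ?_⟩
    rw [mulQuot, Submodule.mapQ_apply, Submodule.Quotient.eq, ← neg_mem_iff]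
    simpa [mem_formsIn, coe_mulForm] using huv

variable [Finite σ]

instance finiteDimensional_homogeneousSubmodule (e : ℕ) :
    FiniteDimensional K (homogeneousSubmodule σ K e) :=
  Module.Finite.iff_fg.2 (homogeneousSubmodule_fg σ K e)

/-- The exchange principle. Let `f` and `h` be forms of positive degrees `d` and `d'`, and let
both quotients by `I + (f)` and by `I + (h)` vanish in high degrees. If `f` is a nonzerodivisor
modulo `I`, then so is `h`, and the degrees from which the two quotients vanish differ by
`d' - d`. -/
theorem RegularModulo.exchange (hI : I.IsHomogeneous (homogeneousSubmodule σ K))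
    {d' : ℕ} {h : MvPolynomial σ K} (hf : f.IsHomogeneous d) (hh : h.IsHomogeneous d')
    (hd : 0 < d) (hd' : 0 < d') (rf : RegularModulo I f) {b : ℕ}
    (ch : ContainsFrom (I ⊔ Ideal.span {h}) b) {c : ℕ}
    (cf : ContainsFrom (I ⊔ Ideal.span {f}) c) :
    RegularModulo I h ∧ ∀ a, ContainsFrom (I ⊔ Ideal.span {f}) (a + d) →
      ContainsFrom (I ⊔ Ideal.span {h}) (a + d') := by
  have per : ∀ a, ContainsFrom (I ⊔ Ideal.span {f}) (a + d) → ∀ e, a ≤ e → ∀ k,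
      hilbert I (e + k * d) = hilbert I e := by
    intro a ha e hae k
    induction k with
    | zero => simp
    | succ k ih =>
      rw [← ih, add_mul, one_mul, ← add_assoc]
      refine (LinearEquiv.finrank_eq (LinearEquiv.ofBijective (mulQuot I hf (e + k * d))
        ⟨(mulQuot_injective_iff hf _).2 (rf _), (mulQuot_surjective_iff hI hf _).2 fun u hu =>
          ha _ u (by omega) hu⟩)).symm
  have nonincr : ∀ e, b ≤ e → ∀ k, hilbert I (e + k * d') ≤ hilbert I e := by
    intro e he k
    induction k with
    | zero => simp
    | succ k ih =>
      refine le_trans ?_ ih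
      rw [add_mul, one_mul, ← add_assoc]
      exact LinearMap.finrank_le_finrank_of_surjective (f := mulQuot I hh (e + k * d'))
        ((mulQuot_surjective_iff hI hh _).2 fun u hu => ch _ u (by omega) hu)
  -- In high degrees multiplication by `h` is surjective between spaces of equal dimension.
  have inj_high : ∀ e, b ≤ e → c ≤ e → ∀ u : MvPolynomial σ K, u.IsHomogeneous e → u * h ∈ I →
      u ∈ I := by
    intro e he hce
    rw [← mulQuot_injective_iff hh]
    have h1 : hilbert I (e + d') = hilbert I e := by
      refine le_antisymm (by simpa using nonincr e he 1) ?_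
      rw [← per c (cf.mono le_rfl (by omega)) e hce d']
      have := nonincr (e + d') (by omega) (d - 1)
      have h2 : e + d' + (d - 1) * d' = e + d' * d := by
        obtain ⟨k, rfl⟩ := Nat.exists_eq_add_of_le' hd
        simp only [Nat.add_sub_cancel]
        ring
      rwa [h2] at this
    exact (LinearMap.injective_iff_surjective_of_finrank_eq_finrank h1.symm).2
      ((mulQuot_surjective_iff hI hh _).2 fun u hu => ch _ u (by omega) hu)
  -- Multiplying by a power of `f` moves any form into the range of degrees covered by `inj_high`.
  have rpow : ∀ (k e : ℕ) (u : MvPolynomial σ K), u.IsHomogeneous e → u * f ^ k ∈ I → u ∈ I := by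
    intro k
    induction k with
    | zero => simp
    | succ k ih =>
      intro e u hu hm
      refine ih e u hu (rf (e + d * k) _ (hu.mul (hf.pow k)) ?_)
      rwa [mul_assoc, ← pow_succ]
  have rh : RegularModulo I h := by
    intro e u hu hm
    refine rpow (b + c) e u hu (inj_high _ ?_ ?_ _ (hu.mul (hf.pow (b + c))) ?_)
    · nlinarith
    · nlinarith
    · rw [mul_right_comm]
      exact I.mul_mem_right _ hm
  refine ⟨rh, fun a ha e u he hu => ?_⟩
  obtain ⟨e, rfl⟩ : ∃ k, e = k + d' := ⟨e - d', by omega⟩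
  -- Now `h` is injective in all degrees, so the dimensions cannot decrease along steps of `d'`;
  -- being `d`-periodic from degree `a` on, they stay equal, and `h` is surjective there.
  have incr : ∀ e k, hilbert I e ≤ hilbert I (e + k * d') := by
    intro e k
    induction k with
    | zero => simp
    | succ k ih =>
      refine ih.trans ?_
      rw [add_mul, one_mul, ← add_assoc]
      exact LinearMap.finrank_le_finrank_of_injective (f := mulQuot I hh (e + k * d'))
        ((mulQuot_injective_iff hh _).2 (rh _))
  have h1 : hilbert I e = hilbert I (e + d') := by
    refine le_antisymm (by simpa using incr e 1) ?_
    rw [← per a ha e (by omega) d']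
    have := incr (e + d') (d - 1)
    have h2 : e + d' + (d - 1) * d' = e + d' * d := by
      obtain ⟨k, rfl⟩ := Nat.exists_eq_add_of_le' hd
      simp only [Nat.add_sub_cancel]
      ring
    rwa [h2] at this
  exact (mulQuot_surjective_iff hI hh e).1
    ((LinearMap.injective_iff_surjective_of_finrank_eq_finrank h1).1
      ((mulQuot_injective_iff hh e).2 (rh e))) u hu

end Graded

/-! ### Macaulay's bound for forms without nontrivial common zero -/

section Families

open MvPolynomial

variable {σ K : Type*} [Field K]

/-- Any subfamily of `f`, in any order, is a regular sequence. -/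
def IsPermutablyRegular (f : σ → MvPolynomial σ K) : Prop :=
  ∀ (J : Finset σ) (i : σ), i ∉ J → RegularModulo (Ideal.span (f '' J)) (f i)

/-- The origin is the only possible common zero of the family `f`. -/
def OnlyTrivialZero (f : σ → MvPolynomial σ K) : Prop :=
  ∀ v : σ → K, (∀ i, eval v (f i) = 0) → v = 0

theorem span_image_insert [DecidableEq σ] (f : σ → MvPolynomial σ K) (J : Finset σ) (i : σ) :
    Ideal.span (f '' (insert i J : Finset σ)) = Ideal.span (f '' J) ⊔ Ideal.span {f i} := by
  rw [Finset.coe_insert, Set.image_insert_eq, Ideal.span_insert, sup_comm]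

theorem span_range_eq_sup [Fintype σ] [DecidableEq σ] (f : σ → MvPolynomial σ K) (i : σ) :
    Ideal.span (Set.range f) =
      Ideal.span (f '' (Finset.univ.erase i : Finset σ)) ⊔ Ideal.span {f i} := by
  rw [← span_image_insert, Finset.insert_erase (Finset.mem_univ i), Finset.coe_univ,
    Set.image_univ]

theorem image_update_of_notMem [DecidableEq σ] (f : σ → MvPolynomial σ K) {J : Finset σ} {i : σ}
    (hi : i ∉ J) (h : MvPolynomial σ K) : Function.update f i h '' J = f '' J :=
  Set.image_congr fun j hj => Function.update_of_ne (by rintro rfl; exact hi hj) _ _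

theorem isHomogeneous_span_image {f : σ → MvPolynomial σ K} {d : σ → ℕ}
    (hf : ∀ i, (f i).IsHomogeneous (d i)) (J : Set σ) :
    (Ideal.span (f '' J)).IsHomogeneous (homogeneousSubmodule σ K) :=
  isHomogeneous_span (by rintro _ ⟨i, -, rfl⟩; exact ⟨_, hf i⟩)

theorem isPermutablyRegular_X : IsPermutablyRegular (X : σ → MvPolynomial σ K) := by
  classical
  intro J i hi e u _ hm
  rw [mem_ideal_span_X_image] at hm ⊢
  intro m hmu
  obtain ⟨j, hj, hj0⟩ := hm (m + Finsupp.single i 1) (by simpa using hmu)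
  refine ⟨j, hj, ?_⟩
  have hij : i ≠ j := by rintro rfl; exact hi hj
  simpa [Finsupp.single_apply, hij] using hj0

variable [Fintype σ]

theorem containsFrom_span_range_X :
    ContainsFrom (Ideal.span (Set.range (X : σ → MvPolynomial σ K))) 1 := by
  intro e u he hu
  rw [← Set.image_univ, mem_ideal_span_X_image]
  intro m hm
  by_contra! hcon
  have h0 : m = 0 := by
    ext i
    exact hcon i trivial
  have := hu (mem_support_iff.1 hm)
  rw [h0] at this
  simp at this
  omega

/-- Replacing one member of a permutably regular family by a form that is regular modulo the
other members keeps the family permutably regular. -/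
theorem IsPermutablyRegular.update [DecidableEq σ] {f : σ → MvPolynomial σ K} {d : σ → ℕ}
    (hf : ∀ i, (f i).IsHomogeneous (d i)) (hd : ∀ i, 0 < d i) (rf : IsPermutablyRegular f)
    {i : σ} {d' : ℕ} {h : MvPolynomial σ K} (hh : h.IsHomogeneous d')
    (rh : RegularModulo (Ideal.span (f '' (Finset.univ.erase i : Finset σ))) h) :
    IsPermutablyRegular (Function.update f i h) := by
  -- Regularity of `h` descends from all other members to any set of other members.
  have key : ∀ (k : ℕ) (J : Finset σ), i ∉ J → (Finset.univ.erase i \ J).card = k →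
      RegularModulo (Ideal.span (f '' J)) h := by
    intro k
    induction k with
    | zero =>
      intro J hi hc
      have : J = Finset.univ.erase i := by
        refine Finset.Subset.antisymm (fun j hj => ?_)
          (Finset.sdiff_eq_empty_iff_subset.1 (Finset.card_eq_zero.1 hc))
        exact Finset.mem_erase.2 ⟨by rintro rfl; exact hi hj, Finset.mem_univ j⟩
      rwa [this]
    | succ k ih =>
      intro J hi hc
      obtain ⟨j, hj⟩ := Finset.card_pos.1 (by omega : 0 < (Finset.univ.erase i \ J).card)
      obtain ⟨hji, hjJ⟩ := Finset.mem_sdiff.1 hj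
      refine RegularModulo.of_sup (isHomogeneous_span_image hf _) (hf j) (hd j) hh
        (rf J j hjJ) ?_
      rw [← span_image_insert]
      refine ih _ ?_ ?_
      · simp only [Finset.mem_insert, not_or]
        exact ⟨(Finset.ne_of_mem_erase hji).symm, hi⟩
      · rw [Finset.sdiff_insert, Finset.card_erase_of_mem hj, hc, Nat.add_sub_cancel]
  intro J j hj
  by_cases hji : j = i
  · subst hji
    rw [Function.update_self, image_update_of_notMem f hj]
    exact key _ J hj rfl
  · rw [Function.update_of_ne hji]
    by_cases hi : i ∈ J
    · rw [← Finset.insert_erase hi, span_image_insert, Function.update_self,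
        image_update_of_notMem f (Finset.notMem_erase i J)]
      refine RegularModulo.swap (isHomogeneous_span_image hf _) (hf j) hh
        (rf _ j fun h => hj (Finset.mem_of_mem_erase h)) ?_
      rw [← span_image_insert]
      refine key _ _ ?_ rfl
      simp only [Finset.mem_insert, Finset.mem_erase, not_or, not_and]
      exact ⟨Ne.symm hji, fun h => absurd rfl h⟩
    · rw [image_update_of_notMem f hi]
      exact rf J j hj

/-- The property propagated by the exchange argument: `f` is permutably regular, and its ideal
contains all forms of degree greater than `∑ (d i - 1)`. -/
def IsMacaulayFamily (d : σ → ℕ) (f : σ → MvPolynomial σ K) : Prop :=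
  IsPermutablyRegular f ∧ ContainsFrom (Ideal.span (Set.range f)) (∑ i, (d i - 1) + 1)

omit [Fintype σ] in
theorem eval_smul_of_isHomogeneous {g : MvPolynomial σ K} {k : ℕ} (hg : g.IsHomogeneous k) (s : K)
    (v : σ → K) : eval (s • v) g = s ^ k * eval v g := by
  rw [eval_eq, eval_eq, Finset.mul_sum]
  refine Finset.sum_congr rfl fun m hm => ?_
  have hdeg : ∑ i ∈ m.support, m i = k := by
    by_contra h
    exact mem_support_iff.1 hm (hg.coeff_eq_zero h)
  simp only [Pi.smul_apply, smul_eq_mul, mul_pow, Finset.prod_mul_distrib,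
    Finset.prod_pow_eq_pow_sum, hdeg]
  ring

section AlgClosed

variable [IsAlgClosed K]

/-- By the Nullstellensatz, an ideal without nontrivial zeros contains all forms of high
degree. -/
theorem OnlyTrivialZero.exists_containsFrom {f : σ → MvPolynomial σ K} (hf : OnlyTrivialZero f) :
    ∃ N, ContainsFrom (Ideal.span (Set.range f)) N := by
  have h1 : ∀ i, X i ∈ (Ideal.span (Set.range f)).radical := by
    intro i
    rw [← vanishingIdeal_zeroLocus_eq_radical (K := K), mem_vanishingIdeal_iff, zeroLocus_span]
    intro v hv
    have : v = 0 := hf v fun j => by simpa [aeval_eq_eval] using hv (f j) ⟨j, rfl⟩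
    simp [this]
  choose k hk using h1
  refine ⟨∑ i, k i + 1, fun e u he hu => ?_⟩
  rw [u.as_sum]
  refine Ideal.sum_mem _ fun m hm => ?_
  have hdeg : m.degree = e := by
    by_contra h
    exact mem_support_iff.1 hm (hu.coeff_eq_zero h)
  obtain ⟨i, hi⟩ : ∃ i, k i ≤ m i := by
    by_contra! h
    have h2 := Finset.sum_le_sum fun i (_ : i ∈ Finset.univ) => (h i).le
    rw [Finsupp.degree_eq_sum] at hdeg
    omega
  have h3 : monomial m (coeff m u) = monomial (m - Finsupp.single i (k i)) (coeff m u) *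
      X i ^ k i := by
    rw [X_pow_eq_monomial, monomial_mul, mul_one, tsub_add_cancel_of_le (by simpa using hi)]
  rw [h3]
  exact Ideal.mul_mem_left _ _ (hk i)

/-- Without the equation of `f i`, a family without nontrivial zeros cuts out only finitely many
lines, represented here by the points on them where `f i` takes the value `1`: modulo the other
members and `f i - 1`, every polynomial is equivalent to one of bounded degree. -/
theorem OnlyTrivialZero.finite_normalized_zeros {f : σ → MvPolynomial σ K} {d : σ → ℕ}
    (hf : ∀ i, (f i).IsHomogeneous (d i)) (hd : ∀ i, 0 < d i) (tf : OnlyTrivialZero f) (i : σ) :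
    {v : σ → K | (∀ j, j ≠ i → eval v (f j) = 0) ∧ eval v (f i) = 1}.Finite := by
  classical
  set W := {v : σ → K | (∀ j, j ≠ i → eval v (f j) = 0) ∧ eval v (f i) = 1} with hW
  obtain ⟨N, hN⟩ := tf.exists_containsFrom
  rw [span_range_eq_sup f i] at hN
  let ev : MvPolynomial σ K →ₗ[K] (W → K) :=
    LinearMap.pi fun w => (aeval (R := K) w.1).toLinearMap
  have hev : ∀ u w, ev u w = eval w.1 u := fun u w => by simp [ev, aeval_eq_eval]
  let B : Submodule K (MvPolynomial σ K) := ⨆ e ∈ Finset.range N, homogeneousSubmodule σ K e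
  have hB : (B.map ev).FG := Submodule.FG.map _
    (Submodule.fg_biSup _ _ fun e _ => homogeneousSubmodule_fg σ K e)
  have hhom : ∀ (e : ℕ) (u : MvPolynomial σ K), u.IsHomogeneous e → ev u ∈ B.map ev := by
    intro e
    induction e using Nat.strong_induction_on with
    | _ e ih =>
      intro u hu
      rcases lt_or_ge e N with hlt | hge
      · exact Submodule.mem_map_of_mem
          ((le_iSup₂_of_le (f := fun e (_ : e ∈ Finset.range N) => homogeneousSubmodule σ K e)
            e (Finset.mem_range.2 hlt) le_rfl) hu)
      · obtain ⟨v, hv, hv0, huv⟩ := exists_isHomogeneous_sub_mul_mem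
          (isHomogeneous_span_image hf _) (hf i) hu (hN e u hge hu)
        have huv' : ev u = ev v := by
          ext w
          have h0 : Ideal.span (f '' (Finset.univ.erase i : Finset σ)) ≤
              RingHom.ker (eval w.1) := by
            rw [Ideal.span_le]
            rintro _ ⟨j, hj, rfl⟩
            exact w.2.1 j (Finset.ne_of_mem_erase hj)
          have := h0 huv
          rw [RingHom.mem_ker, map_sub, map_mul, w.2.2, mul_one, sub_eq_zero] at this
          rw [hev, hev, this]
        rw [huv']
        rcases lt_or_ge e (d i) with hlt | hge
        · rw [hv0 hlt, map_zero]
          exact Submodule.zero_mem _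
        · obtain ⟨l, rfl⟩ := Nat.exists_eq_add_of_le' hge
          exact ih l (by have := hd i; omega) v (hv l rfl)
  have hall : ∀ u, ev u ∈ B.map ev := by
    intro u
    rw [← sum_homogeneousComponent u, map_sum]
    exact Submodule.sum_mem _ fun e _ => hhom e _ (homogeneousComponent_isHomogeneous e u)
  -- Each coordinate satisfies a polynomial equation on `W`.
  have hcoord : ∀ j : σ, ∃ q : Polynomial K, q ≠ 0 ∧ ∀ w ∈ W, q.eval (w j) = 0 := by
    intro j
    let φ : Polynomial K →ₗ[K] B.map ev :=
      (ev.comp (Polynomial.aeval (X j : MvPolynomial σ K)).toLinearMap).codRestrict _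
        fun q => hall _
    have : FiniteDimensional K (B.map ev) := Module.Finite.iff_fg.2 hB
    have hφ : ¬ Function.Injective φ := fun h =>
      Polynomial.not_finite (R := K) (Module.Finite.of_injective φ h)
    rw [injective_iff_map_eq_zero] at hφ
    push Not at hφ
    obtain ⟨q, hq, hq0⟩ := hφ
    refine ⟨q, hq0, fun w hw => ?_⟩
    have h1 : ev (Polynomial.aeval (X j) q) ⟨w, hw⟩ = 0 := by
      have := congrArg Subtype.val hq
      exact congrFun this ⟨w, hw⟩
    have h2 : ev (Polynomial.aeval (X j) q) ⟨w, hw⟩ = q.eval (w j) := by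
      change aeval (R := K) w (Polynomial.aeval (X j) q) = _
      rw [← Polynomial.aeval_algHom_apply, aeval_X, Polynomial.coe_aeval_eq_eval]
    rw [← h2, h1]
  choose q hq0 hq using hcoord
  refine (Set.Finite.pi' fun j => ((q j).roots.toFinset.finite_toSet)).subset fun w hw j => ?_
  simpa [hq0 j] using hq j w hw

omit [IsAlgClosed K] in
theorem exists_linear_form_eval_ne_zero [Infinite K] {W : Set (σ → K)} (hW : W.Finite)
    (h0 : (0 : σ → K) ∉ W) :
    ∃ l : MvPolynomial σ K, l.IsHomogeneous 1 ∧ ∀ w ∈ W, eval w l ≠ 0 := by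
  classical
  have := hW.to_subtype
  obtain ⟨φ, hφ⟩ := Module.exists_dual_forall_apply_ne_zero (K := K)
    (fun w : W => (w : σ → K)) fun w hw => h0 (hw ▸ w.2)
  refine ⟨∑ i, C (φ (Pi.single i 1)) * X i,
    IsHomogeneous.sum _ _ _ fun i _ => isHomogeneous_C_mul_X _ _, fun w hw => ?_⟩
  convert hφ ⟨w, hw⟩ using 1
  rw [LinearMap.pi_apply_eq_sum_univ φ w, map_sum]
  refine Finset.sum_congr rfl fun i _ => ?_
  rw [map_mul, eval_C, eval_X, smul_eq_mul, mul_comm]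
  congr 2
  ext j
  simp [Pi.single_apply, eq_comm]

omit [Fintype σ] in
/-- If a form `l` does not vanish on the finitely many lines cut out by the members of `f` other
than `f i`, then `f i` can be replaced by `l`. -/
theorem OnlyTrivialZero.update [DecidableEq σ] {f : σ → MvPolynomial σ K} {d : σ → ℕ}
    (hf : ∀ i, (f i).IsHomogeneous (d i)) (hd : ∀ i, 0 < d i) (tf : OnlyTrivialZero f) (i : σ)
    {l : MvPolynomial σ K} {k : ℕ} (hl : l.IsHomogeneous k)
    (h : ∀ v : σ → K, (∀ j, j ≠ i → eval v (f j) = 0) → eval v (f i) = 1 → eval v l ≠ 0) :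
    OnlyTrivialZero (Function.update f i l) := by
  intro v hv
  have hv' : ∀ j, j ≠ i → eval v (f j) = 0 := fun j hj => by
    simpa [Function.update_of_ne hj] using hv j
  have hvl : eval v l = 0 := by simpa using hv i
  by_contra hv0
  have hfi : eval v (f i) ≠ 0 := fun h0 => hv0 (tf v fun j => by
    by_cases hj : j = i
    · rw [hj, h0]
    · exact hv' j hj)
  obtain ⟨s, hs⟩ := IsAlgClosed.exists_pow_nat_eq (eval v (f i))⁻¹ (hd i)
  refine h (s • v) (fun j hj => ?_) ?_ ?_
  · rw [eval_smul_of_isHomogeneous (hf j), hv' j hj, mul_zero]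
  · rw [eval_smul_of_isHomogeneous (hf i), hs, inv_mul_cancel₀ hfi]
  · rw [eval_smul_of_isHomogeneous hl, hvl, mul_zero]

/-- One step of the exchange: a member of a Macaulay family may be replaced by any form of positive
degree, as long as the new family has no nontrivial zero either. -/
theorem IsMacaulayFamily.update [DecidableEq σ] {f : σ → MvPolynomial σ K} {d : σ → ℕ}
    (hf : ∀ i, (f i).IsHomogeneous (d i)) (hd : ∀ i, 0 < d i) (tf : OnlyTrivialZero f)
    (mf : IsMacaulayFamily d f) {i : σ} {k : ℕ} {h : MvPolynomial σ K} (hh : h.IsHomogeneous k)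
    (hk : 0 < k) (th : OnlyTrivialZero (Function.update f i h)) :
    IsMacaulayFamily (Function.update d i k) (Function.update f i h) := by
  obtain ⟨rf, cf⟩ := mf
  obtain ⟨N, hN⟩ := tf.exists_containsFrom
  obtain ⟨N', hN'⟩ := th.exists_containsFrom
  rw [span_range_eq_sup _ i] at hN hN' cf
  rw [image_update_of_notMem f (Finset.notMem_erase i _), Function.update_self] at hN'
  obtain ⟨rh, ch⟩ := RegularModulo.exchange (isHomogeneous_span_image hf _) (hf i) hh (hd i) hk
    (rf _ i (Finset.notMem_erase i _)) hN' hN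
  refine ⟨rf.update hf hd hh rh, ?_⟩
  rw [span_range_eq_sup _ i, image_update_of_notMem f (Finset.notMem_erase i _),
    Function.update_self]
  have := ch (∑ j ∈ Finset.univ.erase i, (d j - 1)) (cf.mono le_rfl (by
    rw [← Finset.add_sum_erase _ _ (Finset.mem_univ i)]
    have := hd i
    omega))
  refine this.mono le_rfl ?_
  have hsum : ∑ j ∈ Finset.univ.erase i, (Function.update d i k j - 1) =
      ∑ j ∈ Finset.univ.erase i, (d j - 1) :=
    Finset.sum_congr rfl fun j hj => by rw [Function.update_of_ne (Finset.ne_of_mem_erase hj)]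
  rw [← Finset.add_sum_erase _ _ (Finset.mem_univ i), Function.update_self, hsum]
  omega

/-- Two families of forms without nontrivial zeros can be joined by exchanging one member at a
time, so that both or none of them are Macaulay families. The induction is on a set `s` outside of
which they agree; in each step a member of both families is replaced by the same general linear
form. -/
theorem IsMacaulayFamily.transfer (s : Finset σ) : ∀ {f g : σ → MvPolynomial σ K} {d d' : σ → ℕ},
    (∀ i, (f i).IsHomogeneous (d i)) → (∀ i, 0 < d i) → OnlyTrivialZero f →
    (∀ i, (g i).IsHomogeneous (d' i)) → (∀ i, 0 < d' i) → OnlyTrivialZero g →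
    (∀ i, i ∉ s → f i = g i ∧ d i = d' i) → IsMacaulayFamily d f → IsMacaulayFamily d' g := by
  classical
  induction s using Finset.induction_on with
  | empty =>
    intro f g d d' _ _ _ _ _ _ h mf
    rwa [← funext fun i => (h i (Finset.notMem_empty i)).1,
      ← funext fun i => (h i (Finset.notMem_empty i)).2]
  | insert i s his ih =>
    intro f g d d' hf hd tf hg hd' tg h mf
    have hzero : ∀ {f : σ → MvPolynomial σ K} {d : σ → ℕ}, (∀ i, (f i).IsHomogeneous (d i)) →
        (∀ i, 0 < d i) → eval (0 : σ → K) (f i) ≠ 1 := by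
      intro f d hf hd h1
      rw [eval_zero, constantCoeff_eq, (hf i).coeff_eq_zero (by simpa using (hd i).ne)] at h1
      exact zero_ne_one h1
    obtain ⟨l, hl, hlw⟩ := exists_linear_form_eval_ne_zero
      ((tf.finite_normalized_zeros hf hd i).union (tg.finite_normalized_zeros hg hd' i)) (by
        rintro (h0 | h0)
        · exact hzero hf hd h0.2
        · exact hzero hg hd' h0.2)
    have tfl := tf.update hf hd i hl fun v h1 h2 => hlw v (Or.inl ⟨h1, h2⟩)
    have tgl := tg.update hg hd' i hl fun v h1 h2 => hlw v (Or.inr ⟨h1, h2⟩)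
    have hom : ∀ {f : σ → MvPolynomial σ K} {d : σ → ℕ}, (∀ i, (f i).IsHomogeneous (d i)) →
        ∀ j, (Function.update f i l j).IsHomogeneous (Function.update d i 1 j) := by
      intro f d hf j
      by_cases hj : j = i
      · subst hj
        simpa using hl
      · simpa [Function.update_of_ne hj] using hf j
    have pos : ∀ {d : σ → ℕ}, (∀ i, 0 < d i) → ∀ j, 0 < Function.update d i 1 j := by
      intro d hd j
      by_cases hj : j = i
      · subst hj
        simp
      · simpa [Function.update_of_ne hj] using hd j
    have mgl := ih (hom hf) (pos hd) tfl (hom hg) (pos hd') tgl (fun j hj => by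
      by_cases hji : j = i
      · subst hji
        simp
      · simpa [Function.update_of_ne hji] using h j (by simp [hji, hj]))
      (mf.update hf hd tf hl one_pos tfl)
    have := mgl.update (hom hg) (pos hd') tgl (hg i) (hd' i) (i := i) (by simpa using tg)
    simpa using this

/-- Macaulay's bound: forms of degrees `d i`, as many as there are variables and without nontrivial
common zero, generate an ideal that contains all forms of degree greater than `∑ (d i - 1)`. -/
theorem OnlyTrivialZero.containsFrom {f : σ → MvPolynomial σ K} {d : σ → ℕ}
    (hf : ∀ i, (f i).IsHomogeneous (d i)) (hd : ∀ i, 0 < d i) (tf : OnlyTrivialZero f) :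
    ContainsFrom (Ideal.span (Set.range f)) (∑ i, (d i - 1) + 1) :=
  (IsMacaulayFamily.transfer Finset.univ (f := X) (d := fun _ => 1) (isHomogeneous_X K)
    (fun _ => one_pos) (fun v hv => funext fun i => by simpa using hv i) hf hd tf
    (fun i hi => absurd (Finset.mem_univ i) hi)
    ⟨isPermutablyRegular_X, by simpa using containsFrom_span_range_X⟩).2

end AlgClosed

end Families

/-! ### The matrix `M_T` and the common zeros of the forms `G_{T,i}` -/

/-- A matrix over a field has a nonzero maximal minor if and only if its rows span. -/
theorem exists_det_submatrix_ne_zero_iff {R C K : Type*} [Field K] [Fintype C] [DecidableEq C]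
    (A : Matrix R C K) :
    (∃ s : C ↪ R, (A.submatrix s id).det ≠ 0) ↔ Submodule.span K (Set.range A) = ⊤ := by
  constructor
  · rintro ⟨s, hs⟩
    have h1 : LinearIndependent K (A.submatrix s id).row :=
      Matrix.linearIndependent_rows_iff_isUnit.2
        ((Matrix.isUnit_iff_isUnit_det _).2 (isUnit_iff_ne_zero.2 hs))
    have h2 := h1.span_eq_top_of_card_eq_finrank' (by simp)
    rw [eq_top_iff, ← h2]
    refine Submodule.span_mono ?_
    rintro _ ⟨c, rfl⟩
    exact ⟨s c, rfl⟩
  · intro h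
    obtain ⟨κ, a, ha, hspan, hli⟩ := exists_linearIndependent' K A
    have hb : ⊤ ≤ Submodule.span K (Set.range (A ∘ a)) := by rw [hspan, h]
    let b := Module.Basis.mk hli hb
    let e : C ≃ κ := (Pi.basisFun K C).indexEquiv b
    refine ⟨⟨a ∘ e, ha.comp e.injective⟩, ?_⟩
    have h1 : LinearIndependent K (A.submatrix (a ∘ e) id).row := hli.comp e e.injective
    exact isUnit_iff_ne_zero.1 ((Matrix.isUnit_iff_isUnit_det _).1
      (Matrix.linearIndependent_rows_iff_isUnit.1 h1))

section Field

open MvPolynomial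

theorem isHomogeneous_esymm (σ R : Type*) [CommSemiring R] [Fintype σ] (i : ℕ) :
    (esymm σ R i).IsHomogeneous i := by
  refine IsHomogeneous.sum _ _ _ fun t ht => ?_
  rw [Finset.mem_powersetCard_univ] at ht
  have := IsHomogeneous.prod t (fun k => (X k : MvPolynomial σ R)) (fun _ => 1)
    fun k _ => isHomogeneous_X R k
  simpa [ht] using this

theorem isHomogeneous_G (n : ℕ) (T : Tuple n) (i : Fin (n - 1)) :
    (G n T i).IsHomogeneous (i + 1) := by
  rw [G, shift]
  split_ifs with h
  · have := IsHomogeneous.aeval (isHomogeneous_esymm (Fin (n - 1)) ℤ (i + 1))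
      (fun k : Fin (n - 1) => if k = ⟨T i, h⟩ then -X k else X k - X ⟨T i, h⟩ :
        Fin (n - 1) → MvPolynomial (Fin (n - 1)) ℤ) (n := 1) (fun k => by
        split_ifs
        · exact (isHomogeneous_X ℤ k).neg
        · exact (isHomogeneous_X ℤ k).sub (isHomogeneous_X ℤ _))
    simpa using this
  · exact isHomogeneous_esymm _ _ _

/-- The polynomials `G_{T,i}` over a field `K`. -/
noncomputable def fieldG (K : Type*) [Field K] (n : ℕ) (T : Tuple n) (i : Fin (n - 1)) :
    MvPolynomial (Fin (n - 1)) K :=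
  map (Int.castRingHom K) (G n T i)

variable {K : Type*} [Field K]

theorem isHomogeneous_fieldG (n : ℕ) (T : Tuple n) (i : Fin (n - 1)) :
    (fieldG K n T i).IsHomogeneous (i + 1) :=
  (isHomogeneous_G n T i).map _

/-- For forms of degrees `1, …, n - 1`, Macaulay's bound is the degree `d` of the columns of `M_T`. -/
theorem sum_degree_add_one (n : ℕ) (hn : 1 ≤ n) :
    ∑ i : Fin (n - 1), ((i : ℕ) + 1 - 1) + 1 = macaulayDegree n := by
  have := macaulayDegree_add n hn
  rw [Finset.sum_add_distrib] at this
  simp only [Finset.sum_const, Finset.card_univ, Fintype.card_fin, smul_eq_mul, mul_one] at this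
  simp only [Nat.add_sub_cancel]
  omega

/-- The coefficient vector of a polynomial with respect to the monomials indexing the columns. -/
noncomputable def coeffVector (K : Type*) [Field K] (n : ℕ) :
    MvPolynomial (Fin (n - 1)) K →ₗ[K] (Col n → K) :=
  LinearMap.pi fun c => lcoeff K c.1

@[simp]
theorem coeffVector_apply (n : ℕ) (u : MvPolynomial (Fin (n - 1)) K) (c : Col n) :
    coeffVector K n u c = coeff c.1 u := rfl

theorem degree_eq {m e : ℕ} (c : MultiIndex m e) : c.1.degree = e := by
  rw [Finsupp.degree_eq_sum, c.2]

theorem map_M_apply (n : ℕ) (T : Tuple n) (r : Row n) :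
    (M n T).map (Int.castRingHom K) r =
      coeffVector K n (fieldG K n T r.1 * monomial r.2.1 1) := by
  funext c
  rw [Matrix.map_apply, coeffVector_apply, M, Matrix.of_apply, ← coeff_map, map_mul, map_monomial,
    map_one, fieldG]

theorem eval_eq_sum_coeffVector {n : ℕ} {u : MvPolynomial (Fin (n - 1)) K}
    (hu : u.IsHomogeneous (macaulayDegree n)) (a : Fin (n - 1) → K) :
    eval a u = ∑ c : Col n, coeffVector K n u c * ∏ k, a k ^ c.1 k := by
  rw [eval_eq']
  have h1 : u.support ⊆ Finset.finsuppAntidiag Finset.univ (macaulayDegree n) := by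
    intro m hm
    rw [Finset.mem_finsuppAntidiag]
    refine ⟨?_, Finset.subset_univ _⟩
    rw [← Finsupp.degree_eq_sum]
    by_contra h
    exact mem_support_iff.1 hm (hu.coeff_eq_zero h)
  rw [Finset.sum_subset h1 fun m _ hm => by rw [notMem_support_iff.1 hm, zero_mul]]
  exact Finset.sum_subtype _ (by simp [Finset.mem_finsuppAntidiag]) _

/-- If the rows of the matrix span, all monomials of degree `d` vanish at a common zero. -/
theorem onlyTrivialZero_of_span_eq_top {n : ℕ} (hn : 1 ≤ n) {T : Tuple n}
    (h : Submodule.span K (Set.range ((M n T).map (Int.castRingHom K))) = ⊤) :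
    OnlyTrivialZero (fieldG K n T) := by
  intro a ha
  let φ : (Col n → K) →ₗ[K] K :=
    ∑ c : Col n, (∏ k, a k ^ c.1 k) • LinearMap.proj c
  have hφ : ∀ w, φ w = ∑ c : Col n, w c * ∏ k, a k ^ c.1 k := fun w => by
    simp [φ, mul_comm]
  have hzero : φ = 0 := by
    refine LinearMap.ext_on_range h fun r => ?_
    have hr := le_macaulayDegree n r.1
    have hhom : (fieldG K n T r.1 * monomial r.2.1 1).IsHomogeneous (macaulayDegree n) := by
      convert (isHomogeneous_fieldG n T r.1).mul
        (isHomogeneous_monomial (1 : K) (degree_eq r.2)) using 1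
      omega
    rw [map_M_apply, hφ, ← eval_eq_sum_coeffVector hhom, map_mul, ha, zero_mul,
      LinearMap.zero_apply]
  funext i
  have hpos : 0 < macaulayDegree n := by
    rw [← sum_degree_add_one n hn]
    omega
  have h1 := hφ (coeffVector K n (X i ^ macaulayDegree n))
  rw [hzero, LinearMap.zero_apply, ← eval_eq_sum_coeffVector (by
    simpa using (isHomogeneous_X K i).pow (macaulayDegree n)), map_pow, eval_X] at h1
  exact eq_zero_of_pow_eq_zero h1.symm

/-- The degree `d` part of the ideal generated by the forms `G_{T,i}` is contained in the row space
of the matrix: the products with monomials of other degrees have no coefficients in degree `d`. -/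
theorem coeffVector_mem_span {n : ℕ} {T : Tuple n} {u : MvPolynomial (Fin (n - 1)) K}
    (hu : u ∈ Ideal.span (Set.range (fieldG K n T))) :
    coeffVector K n u ∈ Submodule.span K (Set.range ((M n T).map (Int.castRingHom K))) := by
  obtain ⟨v, rfl⟩ := (Ideal.mem_span_range_iff_exists_fun).1 hu
  rw [map_sum]
  refine Submodule.sum_mem _ fun i _ => ?_
  rw [(v i).as_sum, Finset.sum_mul, map_sum]
  refine Submodule.sum_mem _ fun m _ => ?_
  have h1 : monomial m (coeff m (v i)) * fieldG K n T i =
      coeff m (v i) • (fieldG K n T i * monomial m 1) := by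
    rw [mul_comm, ← mul_smul_comm, smul_monomial, smul_eq_mul, mul_one]
  rw [h1, map_smul]
  refine Submodule.smul_mem _ _ ?_
  by_cases hm : m.degree + (i + 1) = macaulayDegree n
  · refine Submodule.subset_span
      ⟨⟨i, ⟨m, by rw [← Finsupp.degree_eq_sum]; omega⟩⟩, ?_⟩
    rw [map_M_apply]
  · convert Submodule.zero_mem _ using 1
    funext c
    have hhom := (isHomogeneous_fieldG (K := K) n T i).mul
      (isHomogeneous_monomial (1 : K) (rfl : m.degree = m.degree))
    exact hhom.coeff_eq_zero (by rw [degree_eq]; omega)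

/-- By Macaulay's bound, the rows of the matrix span if there is no nontrivial common zero. -/
theorem span_eq_top_of_onlyTrivialZero [IsAlgClosed K] {n : ℕ} (hn : 1 ≤ n) {T : Tuple n}
    (h : OnlyTrivialZero (fieldG K n T)) :
    Submodule.span K (Set.range ((M n T).map (Int.castRingHom K))) = ⊤ := by
  classical
  have h1 := h.containsFrom (isHomogeneous_fieldG n T) fun i => Nat.succ_pos _
  rw [sum_degree_add_one n hn] at h1
  rw [eq_top_iff, ← (Pi.basisFun K (Col n)).span_eq, Submodule.span_le]
  rintro _ ⟨c, rfl⟩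
  have h2 := coeffVector_mem_span (h1 _ _ le_rfl (isHomogeneous_monomial (1 : K) (degree_eq c)))
  have h3 : coeffVector K n (monomial c.1 1) = Pi.basisFun K (Col n) c := by
    funext c'
    rw [Pi.basisFun_apply, coeffVector_apply, coeff_monomial, Pi.single_apply]
    simp [Subtype.ext_iff, eq_comm]
  rwa [h3] at h2

/-- The prime `p` divides all maximal minors of `M_T` if and only if the forms `G_{T,i}` have a
nontrivial common zero in characteristic `p`. -/
theorem dvd_J_iff [IsAlgClosed K] (p : ℕ) [CharP K p] {n : ℕ} (hn : 1 ≤ n) (T : Tuple n) :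
    (p : ℤ) ∣ J n T ↔ ¬ OnlyTrivialZero (fieldG K n T) := by
  have h1 : OnlyTrivialZero (fieldG K n T) ↔
      ∃ s : Col n ↪ Row n, (((M n T).map (Int.castRingHom K)).submatrix s id).det ≠ 0 := by
    rw [exists_det_submatrix_ne_zero_iff]
    exact ⟨span_eq_top_of_onlyTrivialZero hn, onlyTrivialZero_of_span_eq_top hn⟩
  rw [h1, J, Finset.dvd_gcd_iff]
  push Not
  simp only [Finset.mem_univ, true_implies]
  refine forall_congr' fun s => ?_
  rw [← CharP.intCast_eq_zero_iff K p, Matrix.submatrix_map, ← RingHom.mapMatrix_apply,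
    ← RingHom.map_det, eq_intCast]

end Field

/-! ### Casas-Alvero polynomials and their roots -/

section Roots

open Polynomial

variable {K : Type*} [Field K]

/-- The differences of the roots `a_1, …, a_m, 0` with the root of index `j`, leaving out the
difference of that root with itself; for `j ≤ m` the difference with the root `0` takes its
place. The indices are shifted by one, as in `shift`. -/
def differences {m : ℕ} (a : Fin m → K) (j : Fin (m + 1)) (k : Fin m) : K :=
  if h : (j : ℕ) < m then if k = ⟨j, h⟩ then -a k else a k - a ⟨j, h⟩ else a k

/-- The Taylor expansion at a root of a product of linear factors, in terms of the differences of
the roots. -/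
theorem taylor_prod_X_sub_C {m : ℕ} (b : Fin (m + 1) → K) (j : Fin (m + 1)) :
    taylor (b j) (∏ k, (X - C (b k))) =
      X * ∏ k, (X - C (differences (fun k => b k.castSucc - b (Fin.last m)) j k)) := by
  rw [← taylorAlgHom_apply, map_prod]
  simp only [taylorAlgHom_apply, map_sub, taylor_X, taylor_C]
  rw [Fin.prod_univ_castSucc]
  by_cases h : (j : ℕ) < m
  · obtain ⟨j, rfl⟩ : ∃ i : Fin m, j = i.castSucc := ⟨⟨j, h⟩, rfl⟩
    rw [← Finset.mul_prod_erase _ _ (Finset.mem_univ j),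
      ← Finset.mul_prod_erase Finset.univ (fun k => X - C (differences _ _ k))
        (Finset.mem_univ j)]
    have h1 : ∀ k ∈ Finset.univ.erase j,
        X - C (differences (fun k => b k.castSucc - b (Fin.last m)) j.castSucc k) =
          X + C (b j.castSucc) - C (b k.castSucc) := by
      intro k hk
      have hk' := Finset.ne_of_mem_erase hk
      simp only [differences, Fin.val_castSucc, Fin.is_lt, dite_true, Fin.eta, hk', if_false,
        map_sub]
      ring
    rw [Finset.prod_congr rfl h1]
    simp only [differences, Fin.val_castSucc, Fin.is_lt, dite_true, Fin.eta, if_true, map_sub,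
      map_neg]
    ring
  · obtain rfl : j = Fin.last m := Fin.ext (by have := j.isLt; simp; omega)
    simp only [differences, Fin.val_last, lt_irrefl, dite_false, map_sub]
    rw [add_sub_cancel_right, mul_comm]
    congr 1
    refine Finset.prod_congr rfl fun k _ => ?_
    ring

theorem exists_eq_prod_X_sub_C [IsAlgClosed K] {n : ℕ} {f : K[X]} (hf : f.Monic)
    (hn : f.natDegree = n) : ∃ b : Fin n → K, f = ∏ k, (X - C (b k)) := by
  have h1 := (IsAlgClosed.splits f).eq_prod_roots_of_monic hf
  have h2 := IsAlgClosed.card_roots_eq_natDegree (p := f)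
  obtain ⟨l, hl⟩ := Quot.exists_rep f.roots
  rw [← hl] at h1 h2
  have h3 : l.length = n := by rw [← hn, ← h2]; rfl
  subst h3
  refine ⟨fun k => l[k], ?_⟩
  rw [h1]
  exact (Fin.prod_univ_fun_getElem l fun x => X - C x).symm

end Roots

section CommonZeros

open MvPolynomial

variable {K : Type*} [Field K]

theorem aeval_shift_esymm {m : ℕ} (a : Fin m → K) (j : Fin (m + 1)) (i : ℕ) :
    aeval a (shift ℤ (m + 1) j (esymm (Fin (m + 1 - 1)) ℤ i)) =
      (Finset.univ.val.map (differences a j)).esymm i := by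
  rw [← aeval_esymm_eq_multiset_esymm (Fin m) ℤ, shift]
  split_ifs with h
  · rw [← AlgHom.comp_apply]
    congr 1
    refine algHom_ext fun k => ?_
    have h' : (j : ℕ) < m := h
    rw [AlgHom.comp_apply, aeval_X, aeval_X, differences, dif_pos h']
    split_ifs <;> simp
  · rw [AlgHom.id_apply]
    congr 2
    funext k
    have h' : ¬ (j : ℕ) < m := h
    rw [differences, dif_neg h']

/-- The polynomials `G_{T,i}` express that the roots of a split polynomial are also roots of its
Hasse derivatives. -/
theorem eval_hasseDeriv_eq_zero_iff {m : ℕ} (b : Fin (m + 1) → K) (j : Fin (m + 1)) (i : Fin m) :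
    (Polynomial.hasseDeriv (m - i) (∏ k, (Polynomial.X - Polynomial.C (b k)))).eval (b j) = 0 ↔
      aeval (fun k : Fin m => b k.castSucc - b (Fin.last m))
        (shift ℤ (m + 1) j (esymm (Fin (m + 1 - 1)) ℤ (i + 1))) = 0 := by
  obtain ⟨l, hl⟩ : ∃ l, m - i = l + 1 := ⟨m - i - 1, by omega⟩
  rw [← Polynomial.taylor_coeff, taylor_prod_X_sub_C, hl, Polynomial.coeff_X_mul,
    aeval_shift_esymm]
  set w := differences (fun k : Fin m => b k.castSucc - b (Fin.last m)) j
  have h1 := Multiset.prod_X_sub_C_coeff (Finset.univ.val.map w) (k := l) (by simp; omega)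
  rw [Multiset.map_map] at h1
  have h2 : ∏ k, (Polynomial.X - Polynomial.C (w k)) =
    (Multiset.map ((fun t => Polynomial.X - Polynomial.C t) ∘ w) Finset.univ.val).prod := rfl
  rw [h2, h1]
  have h3 : Multiset.card (Finset.univ.val.map w) - l = i + 1 := by simp; omega
  rw [h3]
  simp

theorem eval_fieldG {m : ℕ} (a : Fin m → K) (T : Tuple (m + 1)) (i : Fin m) :
    eval a (fieldG K (m + 1) T i) =
      aeval a (shift ℤ (m + 1) (T i) (esymm (Fin (m + 1 - 1)) ℤ (i + 1))) := by
  rw [fieldG, eval_map, aeval_def, algebraMap_int_eq]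
  rfl

/-- A split polynomial is a Casas-Alvero polynomial if and only if the differences of its roots are
a common zero of the polynomials `G_{T,i}` for some tuple `T`. -/
theorem isCasasAlvero_prod_iff [IsAlgClosed K] {m : ℕ} (b : Fin (m + 1) → K) :
    IsCasasAlvero (∏ k, (Polynomial.X - Polynomial.C (b k))) ↔
      ∃ T : Tuple (m + 1), ∀ i,
        eval (fun k : Fin m => b k.castSucc - b (Fin.last m)) (fieldG K (m + 1) T i) = 0 := by
  have hdeg : (∏ k, (Polynomial.X - Polynomial.C (b k))).natDegree = m + 1 := by
    simp [Polynomial.natDegree_prod_of_monic _ _ fun k _ => Polynomial.monic_X_sub_C (b k)]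
  constructor
  · intro h
    have h1 : ∀ i : Fin m, ∃ j : Fin (m + 1),
        (Polynomial.hasseDeriv (m - i) (∏ k, (Polynomial.X - Polynomial.C (b k)))).eval (b j)
          = 0 := by
      intro i
      obtain ⟨g, hg, hgf, hgh⟩ := h (m - i) (by omega) (by omega)
      obtain ⟨x, hx⟩ := IsAlgClosed.exists_root g
        (by rw [Polynomial.degree_eq_natDegree (by rintro rfl; simp at hg)]; exact_mod_cast hg.ne')
      have hxf := hx.dvd hgf
      rw [Polynomial.IsRoot, Polynomial.eval_prod, Finset.prod_eq_zero_iff] at hxf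
      obtain ⟨j, -, hj⟩ := hxf
      rw [Polynomial.eval_sub, Polynomial.eval_X, Polynomial.eval_C, sub_eq_zero] at hj
      exact ⟨j, hj ▸ hx.dvd hgh⟩
    choose T hT using h1
    refine ⟨T, fun i => ?_⟩
    rw [eval_fieldG]
    exact (eval_hasseDeriv_eq_zero_iff b (T i) i).1 (hT i)
  · rintro ⟨T, hT⟩ i hi1 hi2
    rw [hdeg] at hi2
    let i' : Fin m := ⟨m - i, by omega⟩
    have hi' : m - (i' : ℕ) = i := by simp only [i']; omega
    refine ⟨Polynomial.X - Polynomial.C (b (T i')), by simp,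
      Finset.dvd_prod_of_mem _ (Finset.mem_univ (T i')), ?_⟩
    rw [Polynomial.dvd_iff_isRoot, Polynomial.IsRoot, ← hi', eval_hasseDeriv_eq_zero_iff,
      ← eval_fieldG]
    exact hT i'

/-- Over a fixed algebraically closed field, the powers of linear polynomials are the only
Casas-Alvero polynomials if and only if no tuple `T` admits a nontrivial common zero. -/
theorem forall_isCasasAlvero_iff [IsAlgClosed K] (m : ℕ) :
    (∀ f : Polynomial K, f.Monic → f.natDegree = m + 1 → IsCasasAlvero f →
      ∃ b : K, f = (Polynomial.X - Polynomial.C b) ^ (m + 1)) ↔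
      ∀ T : Tuple (m + 1), OnlyTrivialZero (fieldG K (m + 1) T) := by
  constructor
  · intro h T a ha
    let b : Fin (m + 1) → K := Fin.snoc (α := fun _ => K) (a : Fin m → K) 0
    have hb : (fun k : Fin m => b k.castSucc - b (Fin.last m)) = a := by
      funext k
      simp [b]
    obtain ⟨c, hc⟩ := h (∏ k, (Polynomial.X - Polynomial.C (b k)))
      (Polynomial.monic_prod_of_monic _ _ fun k _ => Polynomial.monic_X_sub_C (b k))
      (by simp [Polynomial.natDegree_prod_of_monic _ _
        fun k _ => Polynomial.monic_X_sub_C (b k)])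
      ((isCasasAlvero_prod_iff b).2 ⟨T, fun i => by rw [hb]; exact ha i⟩)
    have hroot : ∀ k, b k = c := by
      intro k
      have h1 := congrArg (Polynomial.eval (b k)) hc
      rw [Polynomial.eval_prod, Finset.prod_eq_zero (Finset.mem_univ k) (by simp)] at h1
      rw [Polynomial.eval_pow, eq_comm, pow_eq_zero_iff (Nat.succ_ne_zero m)] at h1
      simpa [sub_eq_zero] using h1
    rw [← hb]
    funext k
    simp [hroot]
  · intro h f hf hdeg hca
    obtain ⟨b, rfl⟩ := exists_eq_prod_X_sub_C hf hdeg
    obtain ⟨T, hT⟩ := (isCasasAlvero_prod_iff b).1 hca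
    have h0 := h T _ hT
    refine ⟨b (Fin.last m), ?_⟩
    have hb : ∀ k, b k = b (Fin.last m) := by
      intro k
      refine Fin.lastCases rfl (fun k => ?_) k
      exact sub_eq_zero.1 (congrFun h0 k)
    simp [hb]

end CommonZeros

/-! ### Bad primes -/

theorem dvd_lcm_J_iff {p : ℕ} (hp : p.Prime) (n : ℕ) :
    (p : ℤ) ∣ (Finset.univ : Finset (Tuple n)).lcm (J n) ↔ ∃ T, (p : ℤ) ∣ J n T := by
  constructor
  · intro h
    obtain ⟨T, -, hT⟩ := (Nat.prime_iff_prime_int.1 hp).exists_mem_finset_dvd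
      (h.trans (Finset.lcm_dvd_prod _ _))
    exact ⟨T, hT⟩
  · rintro ⟨T, hT⟩
    exact hT.trans (Finset.dvd_lcm (Finset.mem_univ T))

theorem exists_dvd_J_of_not_casasAlveroHolds {n p : ℕ} (hn : 1 ≤ n)
    (h : ¬ CasasAlveroHolds.{u} n p) : ∃ T : Tuple n, (p : ℤ) ∣ J n T := by
  obtain ⟨m, rfl⟩ := Nat.exists_eq_add_of_le' hn
  by_contra! hcon
  refine h fun K _ _ _ => (forall_isCasasAlvero_iff m).2 fun T => ?_
  by_contra hT
  exact hcon T ((dvd_J_iff (K := K) p hn T).2 hT)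

theorem not_casasAlveroHolds_of_dvd_J {n p : ℕ} (hn : 1 ≤ n) (hp : p.Prime) {T : Tuple n}
    (hT : (p : ℤ) ∣ J n T) : ¬ CasasAlveroHolds.{u} n p := by
  obtain ⟨m, rfl⟩ := Nat.exists_eq_add_of_le' hn
  have : Fact p.Prime := ⟨hp⟩
  intro h
  -- `ULift` places the field in the universe over which `CasasAlveroHolds` quantifies.
  let K := AlgebraicClosure (ULift.{u} (ZMod p))
  have : CharP K p := charP_of_injective_algebraMap
    (FaithfulSMul.algebraMap_injective (ULift.{u} (ZMod p)) K) p
  exact (dvd_J_iff (K := K) p hn T).1 hT ((forall_isCasasAlvero_iff m).1 (h K) T)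

end CasasAlvero

theorem mainTheorem1 (n : ℕ) (hn : 1 ≤ n) (p : ℕ) (hp : p.Prime) :
    (IsBadPrime.{u} n p ↔ ∃ T : CasasAlvero.Tuple n, (p : ℤ) ∣ CasasAlvero.J n T) ∧
      (IsBadPrime.{u} n p ↔
        (p : ℤ) ∣ (Finset.univ : Finset (CasasAlvero.Tuple n)).lcm (CasasAlvero.J n)) := by
  have h : IsBadPrime.{u} n p ↔ ∃ T : CasasAlvero.Tuple n, (p : ℤ) ∣ CasasAlvero.J n T :=
    ⟨fun h => CasasAlvero.exists_dvd_J_of_not_casasAlveroHolds hn h.2,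
      fun ⟨_, hT⟩ => ⟨hp, CasasAlvero.not_casasAlveroHolds_of_dvd_J hn hp hT⟩⟩
  exact ⟨h, h.trans (CasasAlvero.dvd_lcm_J_iff hp n).symm⟩
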